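/- Let $\mathcal H$ be a complex Hilbert space and let $T,T'\in\mathcal B(\mathcal H)$ be contractions ($\|T\|\le 1$, $\|T'\|\le 1$). Suppose that $T$ is Harnack dominated by $T'$, that is, there is a constant $c\ge 1$ such that $$\operatorname{Re} p(T)\le c\,\operatorname{Re} p(T')$$ for every complex polynomial $p$ with $\operatorname{Re} p(z)\ge 0$ for all $|z|\le 1$, where $\operatorname{Re} A=\frac12(A+A^*)$ and $\le$ is the usual order of self-adjoint operators. Then: 1. $T$ is uniformly Cesàro ergodic if and only if $T'$ is, where a contraction $S$ is called uniformly Cesàro ergodic if its Cesàro means $M_n(S)=\frac1{n+1}\sum_{j=0}^n S^j$ converge in operator norm as $n\to\infty$. 2. The sequence $\{T^n\}_{n\ge 0}$ converges in operator norm if and only if $\{T'^n\}_{n\ge 0}$ converges in operator norm. -/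

import Mathlib

open Filter Topology Polynomial
open scoped ComplexStarModule

noncomputable section

/-- `T` is Harnack dominated by `T'`: there is a constant `c ≥ 1` such that
`Re p(T) ≤ c Re p(T')` (in the Loewner order, with `Re A = (A + A*) / 2`) for every analytic
polynomial `p` whose real part is nonnegative on the closed unit disc. -/
def HarnackDominated {H : Type*} [NormedAddCommGroup H] [InnerProductSpace ℂ H] [CompleteSpace H]
    (T T' : H →L[ℂ] H) : Prop :=
  ∃ c : ℝ, 1 ≤ c ∧ ∀ p : ℂ[X], (∀ z : ℂ, ‖z‖ ≤ 1 → 0 ≤ (p.eval z).re) →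
    (ℜ (aeval T p) : H →L[ℂ] H) ≤ c • (ℜ (aeval T' p) : H →L[ℂ] H)

/-- The Cesàro means `M_n(T) = (1 / (n + 1)) ∑_{j = 0}^{n} T ^ j`. -/
def cesaroMean {H : Type*} [NormedAddCommGroup H] [InnerProductSpace ℂ H]
    (T : H →L[ℂ] H) (n : ℕ) : H →L[ℂ] H :=
  (1 / ((n : ℂ) + 1)) • ∑ j ∈ Finset.range (n + 1), T ^ j

/-- A sequence of bounded operators converges uniformly if it converges in operator norm. -/
def ConvergesUniformly {H : Type*} [NormedAddCommGroup H] [InnerProductSpace ℂ H]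
    (A : ℕ → H →L[ℂ] H) : Prop :=
  ∃ P : H →L[ℂ] H, Tendsto (fun n => ‖A n - P‖) atTop (𝓝 0)

/-- `T` is uniformly Cesàro ergodic if its Cesàro means converge in operator norm. -/
def UniformlyCesaroErgodic {H : Type*} [NormedAddCommGroup H] [InnerProductSpace ℂ H]
    (T : H →L[ℂ] H) : Prop :=
  ConvergesUniformly (cesaroMean T)

end

/-! The polynomial `1 - z` gives Re(1 - T) ≤ c Re(1 - T'), and for a contraction Re⟨(1 - T)x, x⟩
dominates ‖(1 - T)x‖²/2. So fixed vectors of T' are fixed by T, and invertibility of 1 - T passes to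
1 - T'.

The converses use Poisson-type polynomials p, huge at 1 but with p(T')(1 - T') bounded: p(T) is huge
on (approximately) fixed vectors of T, while p(T') stays controlled on the range of 1 - T'. Hence
the fixed spaces coincide (`HarnackFormDominated.ker_one_sub_eq`) and 1 - T, 1 - T' are invertible
together (`HarnackFormDominated.isUnit_one_sub_iff`).

Let P project onto the common fixed space. Domination survives passing to T - P and T' - P, which
have no nonzero fixed vectors. Then T is uniformly Cesàro ergodic iff 1 - (T - P) is invertible, and
its powers converge iff 1 - μ(T - P) is invertible for all |μ| = 1; rotation invariance of
domination handles each μ. -/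

/-! ### Contractions, Harnack domination and test polynomials -/

section Contraction

variable {H : Type*} [NormedAddCommGroup H] [InnerProductSpace ℂ H]

/-- The quadratic form version of Harnack domination. -/
def HarnackFormDominated (T T' : H →L[ℂ] H) : Prop :=
  ∃ c : ℝ, 1 ≤ c ∧ ∀ p : ℂ[X], (∀ z : ℂ, ‖z‖ ≤ 1 → 0 ≤ (p.eval z).re) →
    ∀ x : H, (inner ℂ (aeval T p x) x).re ≤ c * (inner ℂ (aeval T' p x) x).re

theorem re_inner_realPart_apply [CompleteSpace H] (A : H →L[ℂ] H) (x : H) :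
    (inner ℂ ((ℜ A : H →L[ℂ] H) x) x).re = (inner ℂ (A x) x).re := by
  have h : (inner ℂ ((star A) x) x).re = (inner ℂ (A x) x).re := by
    rw [ContinuousLinearMap.star_eq_adjoint, ContinuousLinearMap.adjoint_inner_left]
    exact inner_re_symm (𝕜 := ℂ) x (A x)
  rw [realPart_apply_coe]
  simp only [smul_apply, add_apply]
  rw [← Complex.coe_smul, inner_smul_left, Complex.conj_ofReal, Complex.re_ofReal_mul,
    inner_add_left, Complex.add_re, h]
  ring

theorem HarnackDominated.form [CompleteSpace H] {T T' : H →L[ℂ] H} (h : HarnackDominated T T') :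
    HarnackFormDominated T T' := by
  obtain ⟨c, hc, h⟩ := h
  refine ⟨c, hc, fun p hp x => ?_⟩
  have h1 := (ContinuousLinearMap.le_def _ _).1 (h p hp)
  have h2 := h1.re_inner_nonneg_left x
  simp only [sub_apply, smul_apply] at h2
  rw [inner_sub_left, ← Complex.coe_smul, inner_smul_left, Complex.conj_ofReal] at h2
  simp only [RCLike.re_to_complex, Complex.sub_re, Complex.re_ofReal_mul,
    re_inner_realPart_apply] at h2
  linarith

theorem norm_one_le_one : ‖(1 : H →L[ℂ] H)‖ ≤ 1 := ContinuousLinearMap.norm_id_le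

theorem norm_pow_le_one_of_contraction {T : H →L[ℂ] H} (hT : ‖T‖ ≤ 1) (n : ℕ) : ‖T ^ n‖ ≤ 1 := by
  induction n with
  | zero => simpa using norm_one_le_one
  | succ n ih =>
    rw [pow_succ]
    exact (norm_mul_le _ _).trans (mul_le_one₀ ih (norm_nonneg _) hT)

theorem norm_apply_le_of_contraction {T : H →L[ℂ] H} (hT : ‖T‖ ≤ 1) (x : H) : ‖T x‖ ≤ ‖x‖ := by
  simpa using T.le_of_opNorm_le hT x

theorem norm_one_sub_apply_sq_le {T : H →L[ℂ] H} (hT : ‖T‖ ≤ 1) (x : H) :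
    ‖(1 - T) x‖ ^ 2 ≤ 2 * (inner ℂ ((1 - T) x) x).re := by
  have h1 := norm_apply_le_of_contraction hT x
  have h2 := norm_sub_sq (𝕜 := ℂ) x (T x)
  have h3 : ‖T x‖ ^ 2 ≤ ‖x‖ ^ 2 := by gcongr
  have h4 : (inner ℂ x x).re = ‖x‖ ^ 2 := inner_self_eq_norm_sq (𝕜 := ℂ) x
  have h5 : (inner ℂ (T x) x).re = (inner ℂ x (T x)).re := inner_re_symm (𝕜 := ℂ) _ _
  simp only [sub_apply, one_apply_eq_self, inner_sub_left,
    Complex.sub_re, RCLike.re_to_complex] at *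
  linarith

theorem HarnackFormDominated.re_inner_one_sub_le {T T' : H →L[ℂ] H}
    (h : HarnackFormDominated T T') :
    ∃ c : ℝ, 1 ≤ c ∧
      ∀ x, (inner ℂ ((1 - T) x) x).re ≤ c * (inner ℂ ((1 - T') x) x).re := by
  obtain ⟨c, hc, h⟩ := h
  refine ⟨c, hc, fun x => ?_⟩
  have := h (1 - X) (fun z hz => by
    have := Complex.re_le_norm z
    simp; linarith) x
  simpa using this

theorem HarnackFormDominated.rotate {T T' : H →L[ℂ] H} (h : HarnackFormDominated T T') {μ : ℂ}
    (hμ : ‖μ‖ = 1) : HarnackFormDominated (μ • T) (μ • T') := by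
  obtain ⟨c, hc, h⟩ := h
  refine ⟨c, hc, fun p hp x => ?_⟩
  have := h (p.comp (C μ * X)) (fun z hz => by
    rw [eval_comp]
    apply hp
    simpa [hμ] using hz) x
  simpa [aeval_comp, Algebra.algebraMap_eq_smul_one] using this

/-- Truncated Poisson kernels: polynomials with nonnegative real part on the disc that are large at
`1` while `p(T)(1 - T)` stays bounded for all contractions `T`. -/
theorem exists_poisson_polynomial (R : ℝ) :
    ∃ (p : ℂ[X]) (a : ℝ), (∀ z : ℂ, ‖z‖ ≤ 1 → 0 ≤ (p.eval z).re) ∧ p.eval 1 = a ∧ R ≤ a ∧ 0 < a ∧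
      ∀ T : H →L[ℂ] H, ‖T‖ ≤ 1 →
        ‖aeval T p * (1 - T)‖ ≤ 10 ∧ ‖aeval T p‖ ≤ 2 * a := by
  -- The model is (1 + rz)/(1 - rz) with r = 1 - δ, cut off at degree n. The constant ε bounds the
  -- discarded tail; n is so large that ε ≤ 1.
  set δ : ℝ := 1 / (|R| + 4) with hδ
  have hR := abs_nonneg R
  have hδ0 : 0 < δ := by positivity
  have hδ1 : δ ≤ 1 / 4 := by
    rw [hδ]; gcongr; linarith
  set r : ℝ := 1 - δ with hr
  have hr0 : 0 < r := by linarith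
  have hr1 : r < 1 := by linarith
  obtain ⟨n, hn⟩ := exists_pow_lt_of_lt_one (show (0 : ℝ) < δ / 2 by positivity) hr1
  have hrn : 0 ≤ r ^ n := by positivity
  set s : ℝ := ∑ i ∈ Finset.range n, r ^ i with hs
  have hsr : s * δ = 1 - r ^ n := by
    have := geom_sum_mul_neg r n
    rwa [show 1 - r = δ by rw [hr]; ring] at this
  have hs2 : (|R| + 4) / 2 ≤ s := by
    have h1 : 1 / 2 ≤ s * δ := by linarith
    rw [hδ, mul_one_div, le_div_iff₀ (by positivity)] at h1
    linarith
  set ε : ℝ := 2 * r ^ n / δ with hε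
  have hε0 : 0 ≤ ε := by positivity
  have hε1 : ε ≤ 1 := by
    rw [hε, div_le_one hδ0]; linarith
  set S : ℂ[X] := ∑ i ∈ Finset.range n, (C (r : ℂ) * X) ^ i with hS
  refine ⟨2 * S - 1 + C (ε : ℂ), 2 * s - 1 + ε, ?_, ?_, ?_, ?_, ?_⟩
  · intro z hz
    set w : ℂ := r * z with hw
    have hwr : ‖w‖ ≤ r := by
      rw [hw, norm_mul, Complex.norm_real, Real.norm_of_nonneg hr0.le]
      nlinarith
    have hSw : S.eval z = ∑ i ∈ Finset.range n, w ^ i := by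
      simp [hS, eval_finsetSum, hw]
    have hg := geom_sum_mul_neg w n
    have h1w : δ ≤ ‖1 - w‖ := by
      have := norm_sub_norm_le (1 : ℂ) w
      rw [norm_one] at this
      linarith
    have hne : 1 - w ≠ 0 := norm_pos_iff.1 (by linarith)
    have hexp : 2 * S.eval z - 1 = (1 + w) / (1 - w) - 2 * w ^ n / (1 - w) := by
      rw [hSw, ← sub_div, eq_div_iff hne, sub_mul, mul_assoc, hg]; ring
    have hpos : 0 ≤ ((1 + w) / (1 - w)).re := by
      have hw1 : w.re * w.re + w.im * w.im ≤ 1 := by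
        rw [← Complex.normSq_apply, Complex.normSq_eq_norm_sq]
        nlinarith [norm_nonneg w]
      rw [Complex.div_re, ← add_div]
      apply div_nonneg _ (Complex.normSq_nonneg _)
      simp; nlinarith
    have hsmall : (2 * w ^ n / (1 - w)).re ≤ ε := by
      refine (Complex.re_le_norm _).trans ?_
      rw [norm_div, norm_mul, norm_pow, hε]
      gcongr
      simp
    have : ((2 * S - 1 + C (ε : ℂ)).eval z) = (2 * S.eval z - 1) + (ε : ℂ) := by simp
    rw [this, hexp, Complex.add_re, Complex.sub_re, Complex.ofReal_re]
    linarith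
  · simp [hS, hs, eval_finsetSum]
  · have := le_abs_self R
    linarith
  · linarith
  · intro T hT
    have hSpow : ∀ i, ‖((r : ℂ) • T) ^ i‖ ≤ r ^ i := fun i => by
      rw [_root_.smul_pow, norm_smul, norm_pow, Complex.norm_real, Real.norm_of_nonneg hr0.le]
      have := norm_pow_le_one_of_contraction hT i
      have : 0 ≤ r ^ i := by positivity
      nlinarith
    have hST : aeval T S = ∑ i ∈ Finset.range n, ((r : ℂ) • T) ^ i := by
      simp [hS, Algebra.algebraMap_eq_smul_one]
    have hSn : ‖aeval T S‖ ≤ s := by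
      rw [hST]
      exact norm_sum_le_of_le _ fun i _ => hSpow i
    have hε' : ‖aeval T (C (ε : ℂ))‖ ≤ 1 := by
      rw [aeval_C, Algebra.algebraMap_eq_smul_one, norm_smul, Complex.norm_real,
        Real.norm_of_nonneg hε0]
      exact mul_le_one₀ hε1 (norm_nonneg _) norm_one_le_one
    have h1 := norm_one_le_one (H := H)
    have hp : aeval T (2 * S - 1 + C (ε : ℂ)) =
        aeval T S + aeval T S - 1 + aeval T (C (ε : ℂ)) := by
      rw [two_mul]; simp only [map_add, map_sub, map_one]
    constructor
    · have hgeom := geom_sum_mul_neg ((r : ℂ) • T) n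
      rw [← hST] at hgeom
      -- Write 1 - T = (1 - rT) - δT and telescope the first part; sδ ≤ 1 controls the second.
      have hS1 : aeval T S * (1 - T) = 1 - ((r : ℂ) • T) ^ n - (δ : ℂ) • (aeval T S * T) := by
        rw [← hgeom, hr]
        simp only [mul_sub, mul_smul_comm, Complex.ofReal_sub, Complex.ofReal_one, sub_smul,
          one_smul]
        abel
      have hS2 : ‖aeval T S * (1 - T)‖ ≤ 3 := by
        rw [hS1]
        have hb : ‖(δ : ℂ) • (aeval T S * T)‖ ≤ 1 := by
          rw [norm_smul, Complex.norm_real, Real.norm_of_nonneg hδ0.le]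
          have : ‖aeval T S * T‖ ≤ s * 1 :=
            (norm_mul_le _ _).trans (mul_le_mul hSn hT (norm_nonneg _) (by linarith))
          nlinarith
        have hc := hSpow n
        calc _ ≤ ‖(1 : H →L[ℂ] H)‖ + ‖((r : ℂ) • T) ^ n‖ + ‖(δ : ℂ) • (aeval T S * T)‖ :=
              (norm_sub_le _ _).trans (by gcongr; exact norm_sub_le _ _)
          _ ≤ 3 := by linarith
      have hd : ‖(1 : H →L[ℂ] H) - T‖ ≤ 2 := (norm_sub_le _ _).trans (by linarith)
      have he : ‖aeval T (C (ε : ℂ)) * (1 - T)‖ ≤ 1 * 2 :=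
        (norm_mul_le _ _).trans (mul_le_mul hε' hd (norm_nonneg _) zero_le_one)
      rw [hp, add_mul, sub_mul, add_mul, one_mul]
      calc _ ≤ ‖aeval T S * (1 - T)‖ + ‖aeval T S * (1 - T)‖ + ‖1 - T‖
            + ‖aeval T (C (ε : ℂ)) * (1 - T)‖ :=
            (norm_add_le _ _).trans (by
              gcongr
              exact (norm_sub_le _ _).trans (by gcongr; exact norm_add_le _ _))
        _ ≤ 10 := by linarith
    · rw [hp]
      calc _ ≤ ‖aeval T S‖ + ‖aeval T S‖ + ‖(1 : H →L[ℂ] H)‖ + ‖aeval T (C (ε : ℂ))‖ :=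
            (norm_add_le _ _).trans (by
              gcongr
              exact (norm_sub_le _ _).trans (by gcongr; exact norm_add_le _ _))
        _ ≤ _ := by linarith

end Contraction

/-! ### Invertibility of 1 - T and equality of fixed spaces -/

section FixedPoints

variable {H : Type*} [NormedAddCommGroup H] [InnerProductSpace ℂ H]

theorem isUnit_one_sub_iff_coercive [CompleteSpace H] {T : H →L[ℂ] H} (hT : ‖T‖ ≤ 1) :
    IsUnit (1 - T) ↔ ∃ δ : ℝ, 0 < δ ∧ ∀ x, δ * ‖x‖ ^ 2 ≤ (inner ℂ ((1 - T) x) x).re := by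
  constructor
  · rintro ⟨u, hu⟩
    set B : H →L[ℂ] H := ((u⁻¹ : (H →L[ℂ] H)ˣ) : H →L[ℂ] H) with hB
    have hBT : B * (1 - T) = 1 := by rw [← hu, hB, Units.inv_mul]
    have hk : 0 < ‖B‖ + 1 := by positivity
    refine ⟨1 / (2 * (‖B‖ + 1) ^ 2), by positivity, fun x => ?_⟩
    have h1 : ‖x‖ ≤ (‖B‖ + 1) * ‖(1 - T) x‖ := by
      calc ‖x‖ = ‖B ((1 - T) x)‖ := by
            rw [← mul_apply_eq_comp, hBT, one_apply_eq_self]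
        _ ≤ ‖B‖ * ‖(1 - T) x‖ := B.le_opNorm _
        _ ≤ _ := by gcongr; linarith
    have h2 := norm_one_sub_apply_sq_le hT x
    have h3 : ‖x‖ ^ 2 ≤ (‖B‖ + 1) ^ 2 * ‖(1 - T) x‖ ^ 2 := by
      rw [← mul_pow]; gcongr
    rw [div_mul_eq_mul_div, one_mul, div_le_iff₀ (by positivity)]
    calc _ ≤ (‖B‖ + 1) ^ 2 * ‖(1 - T) x‖ ^ 2 := h3
      _ ≤ (‖B‖ + 1) ^ 2 * (2 * (inner ℂ ((1 - T) x) x).re) := by gcongr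
      _ = _ := by ring
  · rintro ⟨δ, hδ, h⟩
    refine ContinuousLinearMap.isUnit_of_forall_le_norm_inner_map _ (c := ⟨δ, hδ.le⟩) hδ
      fun x => ?_
    calc _ = δ * ‖x‖ ^ 2 := mul_comm _ _
      _ ≤ _ := (h x).trans (Complex.re_le_norm _)

theorem exists_aeval_sub_eval_eq_mul (T : H →L[ℂ] H) (p : ℂ[X]) :
    ∃ K : H →L[ℂ] H, Commute K (1 - T) ∧ aeval T p = p.eval 1 • 1 - K * (1 - T) := by
  obtain ⟨q, hq⟩ := X_sub_C_dvd_sub_C_eval (a := (1 : ℂ)) (p := p)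
  refine ⟨aeval T q, ?_, ?_⟩
  · have := (Commute.all q (1 - X)).map (aeval T)
    rwa [map_sub, map_one, aeval_X] at this
  have h := congrArg (aeval T) (hq.trans (mul_comm _ _))
  simp only [map_sub, map_mul, aeval_X, aeval_C, map_one, Algebra.algebraMap_eq_smul_one] at h
  rw [sub_eq_iff_eq_add] at h
  rw [h, ← neg_sub T 1, mul_neg]
  abel

theorem re_inner_le_norm_mul_sq (A : H →L[ℂ] H) (x : H) :
    (inner ℂ (A x) x).re ≤ ‖A‖ * ‖x‖ ^ 2 := by
  calc _ ≤ ‖A x‖ * ‖x‖ := re_inner_le_norm (𝕜 := ℂ) _ _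
    _ ≤ ‖A‖ * ‖x‖ * ‖x‖ := by gcongr; exact A.le_opNorm x
    _ = _ := by ring

theorem re_inner_ofReal_smul_self (a : ℝ) (x : H) :
    (inner ℂ ((a : ℂ) • x) x).re = a * ‖x‖ ^ 2 := by
  rw [inner_smul_left, Complex.conj_ofReal, Complex.re_ofReal_mul]
  congr 1
  exact inner_self_eq_norm_sq (𝕜 := ℂ) x

theorem HarnackFormDominated.isUnit_one_sub_iff [CompleteSpace H] {T T' : H →L[ℂ] H}
    (h : HarnackFormDominated T T') (hT : ‖T‖ ≤ 1) (hT' : ‖T'‖ ≤ 1) :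
    IsUnit (1 - T) ↔ IsUnit (1 - T') := by
  constructor
  · rw [isUnit_one_sub_iff_coercive hT, isUnit_one_sub_iff_coercive hT']
    rintro ⟨δ, hδ, hx⟩
    obtain ⟨c, hc, hcx⟩ := h.re_inner_one_sub_le
    have hc0 : 0 < c := by linarith
    refine ⟨δ / c, by positivity, fun x => ?_⟩
    rw [div_mul_eq_mul_div, div_le_iff₀ hc0, mul_comm _ c]
    exact (hx x).trans (hcx x)
  · rintro ⟨u, hu⟩
    set B : H →L[ℂ] H := ((u⁻¹ : (H →L[ℂ] H)ˣ) : H →L[ℂ] H) with hB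
    have hTB : (1 - T') * B = 1 := by rw [← hu, hB, Units.mul_inv]
    obtain ⟨c, hc, h⟩ := h
    -- Since c Re⟨p(T')x, x⟩ ≤ 10c‖B‖‖x‖², this choice of p(1) leaves a surplus ‖x‖², which only the
    -- term K(1 - T) can absorb.
    obtain ⟨p, a, hp, hpa, hRa, -, hpT⟩ := exists_poisson_polynomial (H := H) (c * (10 * ‖B‖) + 1)
    obtain ⟨K, -, hK⟩ := exists_aeval_sub_eval_eq_mul T p
    have hbd : ‖aeval T' p‖ ≤ 10 * ‖B‖ := by
      calc _ = ‖aeval T' p * (1 - T') * B‖ := by rw [mul_assoc, hTB, mul_one]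
        _ ≤ _ := (norm_mul_le _ _).trans (by gcongr; exact (hpT T' hT').1)
    rw [isUnit_one_sub_iff_coercive hT]
    have hlow : ∀ x, ‖x‖ ≤ (‖K‖ + 1) * ‖(1 - T) x‖ := fun x => by
      rcases eq_or_ne x 0 with rfl | hx0
      · simp
      have hx : 0 < ‖x‖ := norm_pos_iff.2 hx0
      have h1 := h p hp x
      rw [hK, hpa, sub_apply, inner_sub_left, Complex.sub_re, smul_apply, one_apply_eq_self,
        re_inner_ofReal_smul_self] at h1
      have h2 : (inner ℂ ((K * (1 - T)) x) x).re ≤ ‖K‖ * ‖(1 - T) x‖ * ‖x‖ := by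
        refine (re_inner_le_norm (𝕜 := ℂ) _ _).trans ?_
        gcongr
        exact K.le_opNorm _
      have h3 : c * (inner ℂ (aeval T' p x) x).re ≤ c * (10 * ‖B‖) * ‖x‖ ^ 2 := by
        rw [mul_assoc c]
        gcongr
        exact (re_inner_le_norm_mul_sq _ x).trans (by gcongr)
      have h4 : (c * (10 * ‖B‖) + 1) * ‖x‖ ^ 2 ≤ a * ‖x‖ ^ 2 := by gcongr
      have h5 : ‖x‖ * ‖x‖ ≤ ‖K‖ * ‖(1 - T) x‖ * ‖x‖ := by linarith
      have h6 := le_of_mul_le_mul_right h5 hx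
      have := norm_nonneg ((1 - T) x)
      linarith
    refine ⟨1 / (2 * (‖K‖ + 1) ^ 2), by positivity, fun x => ?_⟩
    have h2 := norm_one_sub_apply_sq_le hT x
    have h3 : ‖x‖ ^ 2 ≤ (‖K‖ + 1) ^ 2 * ‖(1 - T) x‖ ^ 2 := by
      rw [← mul_pow]; gcongr; exact hlow x
    rw [div_mul_eq_mul_div, one_mul, div_le_iff₀ (by positivity)]
    calc _ ≤ (‖K‖ + 1) ^ 2 * ‖(1 - T) x‖ ^ 2 := h3
      _ ≤ (‖K‖ + 1) ^ 2 * (2 * (inner ℂ ((1 - T) x) x).re) := by gcongr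
      _ = _ := by ring

theorem one_sub_apply_eq_zero_iff {T : H →L[ℂ] H} (x : H) : (1 - T) x = 0 ↔ T x = x := by
  rw [sub_apply, one_apply_eq_self, sub_eq_zero, eq_comm]

theorem one_sub_apply_eq_zero_of_re_inner_le {T : H →L[ℂ] H} (hT : ‖T‖ ≤ 1) {x : H}
    (h : (inner ℂ ((1 - T) x) x).re ≤ 0) : (1 - T) x = 0 := by
  have h1 := norm_one_sub_apply_sq_le hT x
  have h2 : ‖(1 - T) x‖ ^ 2 = 0 := le_antisymm (by linarith) (by positivity)
  simpa using h2

theorem HarnackFormDominated.apply_eq_self_of_right {T T' : H →L[ℂ] H}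
    (h : HarnackFormDominated T T') (hT : ‖T‖ ≤ 1) {x : H} (hx : T' x = x) : T x = x := by
  obtain ⟨c, -, hcx⟩ := h.re_inner_one_sub_le
  rw [← one_sub_apply_eq_zero_iff] at hx ⊢
  apply one_sub_apply_eq_zero_of_re_inner_le hT
  simpa [hx] using hcx x

theorem adjoint_apply_eq_self [CompleteSpace H] {T : H →L[ℂ] H} (hT : ‖T‖ ≤ 1) {x : H}
    (hx : T x = x) : ContinuousLinearMap.adjoint T x = x := by
  rw [← one_sub_apply_eq_zero_iff] at hx ⊢
  apply one_sub_apply_eq_zero_of_re_inner_le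
  · rwa [← ContinuousLinearMap.star_eq_adjoint, norm_star]
  · rw [sub_apply, one_apply_eq_self, inner_sub_left, ContinuousLinearMap.adjoint_inner_left,
      ← inner_sub_right]
    rw [sub_apply, one_apply_eq_self] at hx
    simp [hx]

theorem adjoint_apply_eq_self_iff [CompleteSpace H] {T : H →L[ℂ] H} (hT : ‖T‖ ≤ 1) (x : H) :
    ContinuousLinearMap.adjoint T x = x ↔ T x = x := by
  refine ⟨fun hx => ?_, adjoint_apply_eq_self hT⟩
  have := adjoint_apply_eq_self (T := ContinuousLinearMap.adjoint T)
    (by rwa [← ContinuousLinearMap.star_eq_adjoint, norm_star]) hx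
  rwa [ContinuousLinearMap.adjoint_adjoint] at this

theorem orthogonal_ker_one_sub [CompleteSpace H] {T : H →L[ℂ] H} (hT : ‖T‖ ≤ 1) :
    (1 - T).kerᗮ = (1 - T).range.topologicalClosure := by
  have h := ContinuousLinearMap.orthogonal_ker (ContinuousLinearMap.adjoint (1 - T))
  rw [ContinuousLinearMap.adjoint_adjoint] at h
  rw [← h]
  congr 1
  ext x
  have : ContinuousLinearMap.adjoint (1 - T) = 1 - ContinuousLinearMap.adjoint T := by
    simp only [← ContinuousLinearMap.star_eq_adjoint, star_sub, star_one]
  rw [this]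
  simp only [LinearMap.mem_ker, ContinuousLinearMap.coe_coe, one_sub_apply_eq_zero_iff]
  exact (adjoint_apply_eq_self_iff hT x).symm

theorem HarnackFormDominated.eq_zero_of_apply_eq_self_of_mem_closure {T T' : H →L[ℂ] H}
    (h : HarnackFormDominated T T') (hT' : ‖T'‖ ≤ 1) {x : H} (hx : T x = x)
    (hcl : x ∈ (1 - T').range.topologicalClosure) : x = 0 := by
  by_contra hx0
  have hxp : 0 < ‖x‖ := norm_pos_iff.2 hx0
  obtain ⟨c, hc, h⟩ := h
  have hc0 : 0 < c := by linarith
  -- This tolerance and the bound 40c‖y‖/‖x‖ below each cost at most a‖x‖/4, so a‖x‖ ≤ a‖x‖/2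
  -- results.
  obtain ⟨_, ⟨y, rfl⟩, hy⟩ := Metric.mem_closure_iff.1 hcl (‖x‖ / (8 * c)) (by positivity)
  simp only [ContinuousLinearMap.coe_coe] at hy
  rw [dist_eq_norm] at hy
  obtain ⟨p, a, hp, hpa, hRa, ha, hpT⟩ :=
    exists_poisson_polynomial (H := H) (40 * c * ‖y‖ / ‖x‖)
  rw [div_le_iff₀ hxp] at hRa
  obtain ⟨h10, h2a⟩ := hpT T' hT'
  obtain ⟨K, -, hK⟩ := exists_aeval_sub_eval_eq_mul T p
  have h1 := h p hp x
  rw [hK, hpa, sub_apply, mul_apply_eq_comp, (one_sub_apply_eq_zero_iff x).2 hx,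
    map_zero, sub_zero, smul_apply, one_apply_eq_self, re_inner_ofReal_smul_self] at h1
  have h2 : ‖aeval T' p x‖ ≤ 10 * ‖y‖ + 2 * a * (‖x‖ / (8 * c)) := by
    have e : aeval T' p x = (aeval T' p * (1 - T')) y + aeval T' p (x - (1 - T') y) := by
      rw [mul_apply_eq_comp, ← map_add]; congr 1; abel
    rw [e]
    refine (norm_add_le _ _).trans (add_le_add ?_ ?_)
    · exact ContinuousLinearMap.le_of_opNorm_le _ h10 y
    · refine (ContinuousLinearMap.le_of_opNorm_le _ h2a _).trans ?_
      gcongr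
  have h3 : a * ‖x‖ ^ 2 ≤ c * ((10 * ‖y‖ + 2 * a * (‖x‖ / (8 * c))) * ‖x‖) := by
    refine h1.trans ?_
    gcongr
    exact (re_inner_le_norm (𝕜 := ℂ) _ _).trans (by gcongr)
  have h4 : c * ((10 * ‖y‖ + 2 * a * (‖x‖ / (8 * c))) * ‖x‖) =
      (10 * c * ‖y‖ + a * ‖x‖ / 4) * ‖x‖ := by
    field_simp
    ring
  rw [h4, sq, ← mul_assoc] at h3
  have h5 := le_of_mul_le_mul_right h3 hxp
  have h6 : 0 < a * ‖x‖ := by positivity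
  linarith

/-- If Tx = x, the component of x orthogonal to the fixed space of T' is still fixed by T and lies
in the closed range of 1 - T', so it vanishes. -/
theorem HarnackFormDominated.ker_one_sub_eq [CompleteSpace H] {T T' : H →L[ℂ] H}
    (h : HarnackFormDominated T T') (hT : ‖T‖ ≤ 1) (hT' : ‖T'‖ ≤ 1) :
    (1 - T).ker = (1 - T').ker := by
  apply le_antisymm
  · intro x hx
    set K := (1 - T').ker with hKdef
    have : CompleteSpace K := (ContinuousLinearMap.isClosed_ker (1 - T')).completeSpace_coe
    simp only [LinearMap.mem_ker, ContinuousLinearMap.coe_coe, one_sub_apply_eq_zero_iff] at hx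
    have hmem := K.starProjection_apply_mem x
    have hfix : T (K.starProjection x) = K.starProjection x := by
      apply h.apply_eq_self_of_right hT
      rw [← one_sub_apply_eq_zero_iff]
      exact LinearMap.mem_ker.1 hmem
    have hz := h.eq_zero_of_apply_eq_self_of_mem_closure hT' (x := x - K.starProjection x)
      (by rw [map_sub, hx, hfix]) (by
        rw [← orthogonal_ker_one_sub hT']
        exact K.sub_starProjection_mem_orthogonal x)
    rw [sub_eq_zero] at hz
    rw [hz]
    exact hmem
  · intro x hx
    simp only [LinearMap.mem_ker, ContinuousLinearMap.coe_coe, one_sub_apply_eq_zero_iff] at hx ⊢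
    exact h.apply_eq_self_of_right hT hx

end FixedPoints

/-! ### Splitting off the fixed space; convergence criteria -/

section FixedProjection

variable {H : Type*} [NormedAddCommGroup H] [InnerProductSpace ℂ H]

/-- `P` is the orthogonal projection onto the fixed space of `T`, and commutes with `T`. -/
structure IsFixedProjection (T P : H →L[ℂ] H) : Prop where
  idem : P * P = P
  symm : ∀ x y, inner ℂ (P x) y = inner ℂ x (P y)
  norm_one_sub_le : ‖1 - P‖ ≤ 1
  mul_left : T * P = P
  mul_right : P * T = P
  apply_eq : ∀ x, T x = x → P x = x

theorem isFixedProjection_starProjection_ker [CompleteSpace H] {T : H →L[ℂ] H} (hT : ‖T‖ ≤ 1)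
    (K : Submodule ℂ H) [K.HasOrthogonalProjection] (hK : (1 - T).ker = K) :
    IsFixedProjection T K.starProjection := by
  have hmem : ∀ x, x ∈ K ↔ T x = x := fun x => by
    rw [← hK, ← one_sub_apply_eq_zero_iff]; rfl
  have hfix : ∀ x, T (K.starProjection x) = K.starProjection x := fun x =>
    (hmem _).1 (K.starProjection_apply_mem x)
  refine ⟨K.isIdempotentElem_starProjection, fun x y => K.starProjection_isSymmetric x y, ?_,
    ContinuousLinearMap.ext hfix, ?_, fun x hx => ?_⟩
  · have : (1 : H →L[ℂ] H) - K.starProjection = Kᗮ.starProjection := by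
      rw [Submodule.starProjection_orthogonal]; rfl
    rw [this]
    exact Kᗮ.starProjection_norm_le
  · refine ContinuousLinearMap.ext fun x => ext_inner_right ℂ fun y => ?_
    have h1 : ∀ u v, inner ℂ (K.starProjection u) v = inner ℂ u (K.starProjection v) :=
      fun u v => K.starProjection_isSymmetric u v
    rw [mul_apply_eq_comp, h1, h1, ← ContinuousLinearMap.adjoint_inner_right,
      adjoint_apply_eq_self hT (hfix y)]
  · exact K.starProjection_eq_self_iff.2 ((hmem x).2 hx)

namespace IsFixedProjection

variable {T P : H →L[ℂ] H}

theorem pow_mul (h : IsFixedProjection T P) (n : ℕ) : T ^ n * P = P := by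
  induction n with
  | zero => simp
  | succ n ih => rw [pow_succ, mul_assoc, h.mul_left, ih]

theorem mul_pow (h : IsFixedProjection T P) (n : ℕ) : P * T ^ n = P := by
  induction n with
  | zero => simp
  | succ n ih => rw [pow_succ, ← mul_assoc, ih, h.mul_right]

theorem sub_pow_succ (h : IsFixedProjection T P) (n : ℕ) :
    (T - P) ^ (n + 1) = T ^ (n + 1) - P := by
  induction n with
  | zero => simp
  | succ n ih =>
    rw [pow_succ, ih, mul_sub, sub_mul, sub_mul, h.pow_mul, h.mul_right, h.idem, ← pow_succ]
    abel

theorem norm_sub_le (h : IsFixedProjection T P) (hT : ‖T‖ ≤ 1) : ‖T - P‖ ≤ 1 := by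
  have : T - P = T * (1 - P) := by rw [mul_sub, mul_one, h.mul_left]
  rw [this]
  exact (norm_mul_le _ _).trans (mul_le_one₀ hT (norm_nonneg _) h.norm_one_sub_le)

theorem eq_zero_of_sub_apply_eq_self (h : IsFixedProjection T P) {x : H} (hx : (T - P) x = x) :
    x = 0 := by
  have h1 : P x = 0 := by
    calc P x = P ((T - P) x) := by rw [hx]
      _ = (P * (T - P)) x := rfl
      _ = 0 := by rw [mul_sub, h.mul_right, h.idem, sub_self]; rfl
  have h2 : T x = x := by
    rw [sub_apply, h1, sub_zero] at hx
    exact hx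
  rw [← h.apply_eq x h2, h1]

/-- Positive powers of T - P vanish on the range of P, but the zeroth power is 1; hence the term
p(0)P. -/
theorem aeval_sub (h : IsFixedProjection T P) (p : ℂ[X]) :
    aeval (T - P) p = aeval T p * (1 - P) + p.eval 0 • P := by
  induction p using Polynomial.induction_on' with
  | add p q hp hq => rw [map_add, map_add, hp, hq, eval_add, add_smul, add_mul]; abel
  | monomial n a =>
    rw [aeval_monomial, aeval_monomial, Algebra.algebraMap_eq_smul_one]
    cases n with
    | zero => simp [smul_sub]
    | succ n =>
      rw [h.sub_pow_succ]
      simp [mul_sub, h.pow_mul]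

theorem mul_aeval (h : IsFixedProjection T P) (p : ℂ[X]) :
    P * aeval T p = p.eval 1 • P := by
  induction p using Polynomial.induction_on' with
  | add p q hp hq => rw [map_add, mul_add, hp, hq, eval_add, add_smul]
  | monomial n a =>
    rw [aeval_monomial, Algebra.algebraMap_eq_smul_one]
    simp [h.mul_pow]

theorem re_inner_aeval_sub (h : IsFixedProjection T P) (p : ℂ[X]) (x : H) :
    (inner ℂ (aeval (T - P) p x) x).re =
      (inner ℂ (aeval T p (x - P x)) (x - P x)).re + (p.eval 0).re * ‖P x‖ ^ 2 := by
  have hPP : ∀ y, P (P y) = P y := fun y => by rw [← mul_apply_eq_comp, h.idem]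
  have h1 : inner ℂ (aeval T p (x - P x)) (P x) = 0 := by
    rw [← h.symm, ← mul_apply_eq_comp, h.mul_aeval, smul_apply, map_sub, hPP]
    simp
  have h2 : inner ℂ (P x) x = ((‖P x‖ ^ 2 : ℝ) : ℂ) := by
    rw [← hPP x, h.symm, hPP]
    simp
  rw [h.aeval_sub, add_apply, mul_apply_eq_comp, sub_apply, one_apply_eq_self, inner_add_left,
    smul_apply, inner_smul_left, h2, inner_sub_right, h1, sub_zero, Complex.add_re,
    Complex.re_mul_ofReal, Complex.conj_re]

end IsFixedProjection

/-- Both forms gain the same nonnegative term Re p(0)‖Px‖², which c ≥ 1 absorbs. -/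
theorem HarnackFormDominated.sub_fixedProjection {T T' P : H →L[ℂ] H}
    (h : HarnackFormDominated T T') (hP : IsFixedProjection T P) (hP' : IsFixedProjection T' P) :
    HarnackFormDominated (T - P) (T' - P) := by
  obtain ⟨c, hc, h⟩ := h
  refine ⟨c, hc, fun p hp x => ?_⟩
  rw [hP.re_inner_aeval_sub, hP'.re_inner_aeval_sub, mul_add]
  have h0 : 0 ≤ (p.eval 0).re * ‖P x‖ ^ 2 := mul_nonneg (hp 0 (by simp)) (by positivity)
  refine add_le_add (h p hp _) ?_
  nlinarith

/-- The Neumann series inverts 1 - p(S), which has 1 - S as a commuting factor. -/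
theorem isUnit_one_sub_of_norm_aeval_lt [CompleteSpace H] {S : H →L[ℂ] H} (p : ℂ[X])
    (hp : p.eval 1 = 1) (hS : ‖aeval S p‖ < 1) : IsUnit (1 - S) := by
  obtain ⟨K, hK, hKS⟩ := exists_aeval_sub_eval_eq_mul S p
  have h1 : IsUnit (K * (1 - S)) := by
    have : K * (1 - S) = 1 - aeval S p := by rw [hKS, hp, one_smul]; abel
    rw [this]
    exact isUnit_one_sub_of_norm_lt_one hS
  exact (hK.isUnit_mul_iff.1 h1).2

theorem convergesUniformly_iff {A : ℕ → H →L[ℂ] H} :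
    ConvergesUniformly A ↔ ∃ P, Tendsto A atTop (𝓝 P) :=
  exists_congr fun _ => tendsto_iff_norm_sub_tendsto_zero.symm

theorem cesaroMean_mul_one_sub (S : H →L[ℂ] H) (n : ℕ) :
    cesaroMean S n * (1 - S) = (1 / ((n : ℂ) + 1)) • (1 - S ^ (n + 1)) := by
  rw [cesaroMean, smul_mul_assoc, geom_sum_mul_neg]

theorem one_sub_mul_cesaroMean (S : H →L[ℂ] H) (n : ℕ) :
    (1 - S) * cesaroMean S n = (1 / ((n : ℂ) + 1)) • (1 - S ^ (n + 1)) := by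
  rw [cesaroMean, mul_smul_comm, mul_neg_geom_sum]

theorem tendsto_inv_smul_one_sub_pow {S : H →L[ℂ] H} (hS : ‖S‖ ≤ 1) :
    Tendsto (fun n : ℕ => (1 / ((n : ℂ) + 1)) • (1 - S ^ (n + 1))) atTop (𝓝 0) := by
  refine squeeze_zero_norm (a := fun n : ℕ => 2 * (1 / ((n : ℝ) + 1))) (fun n => ?_) ?_
  · have h1 : ‖1 - S ^ (n + 1)‖ ≤ 2 := by
      have := norm_pow_le_one_of_contraction hS (n + 1)
      have := norm_one_le_one (H := H)
      exact (norm_sub_le _ _).trans (by linarith)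
    have h2 : ‖(1 / ((n : ℂ) + 1))‖ = 1 / ((n : ℝ) + 1) := by
      rw [norm_div, norm_one]
      congr 1
      exact_mod_cast Complex.norm_natCast (n + 1)
    rw [norm_smul, h2, mul_comm]
    gcongr
  · simpa using (tendsto_one_div_add_atTop_nhds_zero_nat (𝕜 := ℝ)).const_mul 2

theorem eq_zero_of_one_sub_mul_eq_zero {S Q : H →L[ℂ] H} (hfix : ∀ x, S x = x → x = 0)
    (hQ : (1 - S) * Q = 0) : Q = 0 := by
  ext x
  apply hfix
  rw [← one_sub_apply_eq_zero_iff, ← mul_apply_eq_comp, hQ]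
  rfl

theorem aeval_cesaro_polynomial (S : H →L[ℂ] H) (n : ℕ) :
    aeval S (C (1 / ((n : ℂ) + 1)) * ∑ j ∈ Finset.range (n + 1), X ^ j) = cesaroMean S n := by
  simp [cesaroMean, Algebra.algebraMap_eq_smul_one]

theorem exists_tendsto_cesaroMean_iff_isUnit [CompleteSpace H] {S : H →L[ℂ] H} (hS : ‖S‖ ≤ 1)
    (hfix : ∀ x, S x = x → x = 0) :
    (∃ Q, Tendsto (cesaroMean S) atTop (𝓝 Q)) ↔ IsUnit (1 - S) := by
  have hlim := tendsto_inv_smul_one_sub_pow hS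
  constructor
  · rintro ⟨Q, hQ⟩
    have h1 := hQ.const_mul (1 - S)
    simp only [one_sub_mul_cesaroMean] at h1
    -- The limit maps into the fixed space of S, so it is 0 and some Cesàro mean has norm below 1.
    have hQ0 := eq_zero_of_one_sub_mul_eq_zero hfix (tendsto_nhds_unique h1 hlim)
    rw [hQ0] at hQ
    have h2 : ∀ᶠ n in atTop, ‖cesaroMean S n‖ < 1 :=
      hQ.norm.eventually_lt_const (by simp)
    obtain ⟨n, hn⟩ := h2.exists
    rw [← aeval_cesaro_polynomial] at hn
    refine isUnit_one_sub_of_norm_aeval_lt _ ?_ hn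
    have : (n : ℂ) + 1 ≠ 0 := Nat.cast_add_one_ne_zero n
    simp [eval_finsetSum, this]
  · rintro ⟨u, hu⟩
    refine ⟨0, ?_⟩
    have h1 := hlim.mul_const ((u⁻¹ : (H →L[ℂ] H)ˣ) : H →L[ℂ] H)
    rw [zero_mul] at h1
    refine h1.congr fun n => ?_
    rw [← cesaroMean_mul_one_sub, ← hu, mul_assoc, Units.mul_inv, mul_one]

/-- The spectrum misses the unit circle, so by compactness the spectral radius is below 1, and
Gelfand's formula gives geometric decay. -/
theorem tendsto_pow_zero_of_isUnit_one_sub_smul [CompleteSpace H] {S : H →L[ℂ] H} (hS : ‖S‖ ≤ 1)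
    (h : ∀ μ : ℂ, ‖μ‖ = 1 → IsUnit (1 - μ • S)) :
    Tendsto (fun n : ℕ => S ^ n) atTop (𝓝 0) := by
  rcases subsingleton_or_nontrivial H with hH | hH
  · exact tendsto_const_nhds.congr fun n => Subsingleton.elim _ _
  have hlt : ∀ z ∈ spectrum ℂ S, ‖z‖₊ < 1 := fun z hz => by
    rw [← NNReal.coe_lt_coe, coe_nnnorm, NNReal.coe_one]
    refine lt_of_le_of_ne ((spectrum.norm_le_norm_of_mem hz).trans hS) fun hz1 => ?_
    have hz0 : z ≠ 0 := norm_pos_iff.1 (by rw [hz1]; exact one_pos)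
    refine hz ?_
    have hu := h z⁻¹ (by rw [norm_inv, hz1, inv_one])
    have : algebraMap ℂ (H →L[ℂ] H) z - S = Units.mk0 z hz0 • (1 - z⁻¹ • S) := by
      rw [Units.smul_mk0, smul_sub, smul_inv_smul₀ hz0, Algebra.algebraMap_eq_smul_one]
    rw [spectrum.mem_resolventSet_iff, this]
    exact hu.smul _
  have hrad : spectralRadius ℂ S < 1 := spectrum.spectralRadius_lt_of_forall_lt S hlt
  obtain ⟨s, hs, hs1⟩ := exists_between hrad
  have hs' : s ≠ ⊤ := (hs1.trans ENNReal.one_lt_top).ne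
  lift s to NNReal using hs'
  have hev := (spectrum.pow_nnnorm_pow_one_div_tendsto_nhds_spectralRadius S).eventually_lt_const hs
  refine squeeze_zero_norm' (a := fun n : ℕ => (s : ℝ) ^ n) ?_
    (tendsto_pow_atTop_nhds_zero_of_lt_one s.2 (by exact_mod_cast hs1))
  filter_upwards [hev, eventually_ge_atTop 1] with n hn hn1
  have hn0 : (n : ℝ) ≠ 0 := by positivity
  have h1 := ENNReal.rpow_le_rpow hn.le (show (0 : ℝ) ≤ n by positivity)
  rw [← ENNReal.rpow_mul, one_div_mul_cancel hn0, ENNReal.rpow_one, ENNReal.rpow_natCast] at h1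
  exact_mod_cast h1

theorem exists_tendsto_pow_iff_isUnit [CompleteSpace H] {S : H →L[ℂ] H} (hS : ‖S‖ ≤ 1)
    (hfix : ∀ x, S x = x → x = 0) :
    (∃ Q, Tendsto (fun n : ℕ => S ^ n) atTop (𝓝 Q)) ↔
      ∀ μ : ℂ, ‖μ‖ = 1 → IsUnit (1 - μ • S) := by
  refine ⟨?_, fun h => ⟨0, tendsto_pow_zero_of_isUnit_one_sub_smul hS h⟩⟩
  rintro ⟨Q, hQ⟩ μ hμ
  have h1 : (1 - S) * Q = 0 := by
    have h2 := hQ.const_mul S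
    have h3 := (tendsto_add_atTop_iff_nat 1).2 hQ
    simp only [pow_succ'] at h3
    rw [sub_mul, one_mul, tendsto_nhds_unique h2 h3, sub_self]
  rw [eq_zero_of_one_sub_mul_eq_zero hfix h1] at hQ
  have h2 : ∀ᶠ n in atTop, ‖S ^ n‖ < 1 := hQ.norm.eventually_lt_const (by simp)
  obtain ⟨n, hn⟩ := h2.exists
  refine isUnit_one_sub_of_norm_aeval_lt (X ^ n) (by simp) ?_
  rw [map_pow, aeval_X, _root_.smul_pow, norm_smul, norm_pow, hμ, one_pow, one_mul]
  exact hn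

theorem exists_tendsto_iff_of_sub_tendsto {A B : ℕ → H →L[ℂ] H} {P : H →L[ℂ] H}
    (h : Tendsto (fun n => A n - B n) atTop (𝓝 P)) :
    (∃ Q, Tendsto A atTop (𝓝 Q)) ↔ ∃ Q, Tendsto B atTop (𝓝 Q) := by
  constructor
  · rintro ⟨Q, hQ⟩
    exact ⟨Q - P, by simpa using hQ.sub h⟩
  · rintro ⟨Q, hQ⟩
    exact ⟨Q + P, by simpa using hQ.add h⟩

theorem IsFixedProjection.cesaroMean_sub {T P : H →L[ℂ] H} (h : IsFixedProjection T P) (n : ℕ) :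
    cesaroMean T n - cesaroMean (T - P) n = P - (1 / ((n : ℂ) + 1)) • P := by
  have hn : (n : ℂ) + 1 ≠ 0 := Nat.cast_add_one_ne_zero n
  rw [cesaroMean, cesaroMean, ← smul_sub, ← Finset.sum_sub_distrib, Finset.sum_range_succ']
  simp only [h.sub_pow_succ, sub_sub_cancel, pow_zero, sub_self, add_zero, Finset.sum_const,
    Finset.card_range]
  rw [← Nat.cast_smul_eq_nsmul ℂ, smul_smul]
  nth_rewrite 2 [← one_smul ℂ P]
  rw [← sub_smul]
  congr 1
  field_simp
  ring

theorem IsFixedProjection.uniformlyCesaroErgodic_iff [CompleteSpace H] {T P : H →L[ℂ] H}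
    (h : IsFixedProjection T P) (hT : ‖T‖ ≤ 1) :
    UniformlyCesaroErgodic T ↔ IsUnit (1 - (T - P)) := by
  rw [UniformlyCesaroErgodic, convergesUniformly_iff,
    ← exists_tendsto_cesaroMean_iff_isUnit (h.norm_sub_le hT)
      fun _ => h.eq_zero_of_sub_apply_eq_self]
  refine exists_tendsto_iff_of_sub_tendsto (P := P) ?_
  simp only [h.cesaroMean_sub]
  simpa using tendsto_const_nhds.sub
    ((tendsto_one_div_add_atTop_nhds_zero_nat (𝕜 := ℂ)).smul_const P)

theorem IsFixedProjection.convergesUniformly_pow_iff [CompleteSpace H] {T P : H →L[ℂ] H}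
    (h : IsFixedProjection T P) (hT : ‖T‖ ≤ 1) :
    ConvergesUniformly (fun n : ℕ => T ^ n) ↔ ∀ μ : ℂ, ‖μ‖ = 1 → IsUnit (1 - μ • (T - P)) := by
  rw [convergesUniformly_iff, ← exists_tendsto_pow_iff_isUnit (h.norm_sub_le hT)
      fun _ => h.eq_zero_of_sub_apply_eq_self]
  refine exists_tendsto_iff_of_sub_tendsto (P := P) ?_
  rw [← tendsto_add_atTop_iff_nat 1]
  simp only [h.sub_pow_succ, sub_sub_cancel]
  exact tendsto_const_nhds

end FixedProjection

theorem mainTheorem9 {H : Type*} [NormedAddCommGroup H] [InnerProductSpace ℂ H] [CompleteSpace H]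
    (T T' : H →L[ℂ] H) (hT : ‖T‖ ≤ 1) (hT' : ‖T'‖ ≤ 1) (hTT' : HarnackDominated T T') :
    (UniformlyCesaroErgodic T ↔ UniformlyCesaroErgodic T') ∧
      (ConvergesUniformly (fun n : ℕ => T ^ n) ↔ ConvergesUniformly (fun n : ℕ => T' ^ n)) := by
  have hF := hTT'.form
  set K := (1 - T').ker with hK
  have : CompleteSpace K := (ContinuousLinearMap.isClosed_ker (1 - T')).completeSpace_coe
  have hP := isFixedProjection_starProjection_ker hT K (hF.ker_one_sub_eq hT hT')
  have hP' := isFixedProjection_starProjection_ker hT' K rfl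
  have hS := hF.sub_fixedProjection hP hP'
  have hn := hP.norm_sub_le hT
  have hn' := hP'.norm_sub_le hT'
  refine ⟨?_, ?_⟩
  · rw [hP.uniformlyCesaroErgodic_iff hT, hP'.uniformlyCesaroErgodic_iff hT']
    exact hS.isUnit_one_sub_iff hn hn'
  · rw [hP.convergesUniformly_pow_iff hT, hP'.convergesUniformly_pow_iff hT']
    refine forall₂_congr fun μ hμ => (hS.rotate hμ).isUnit_one_sub_iff ?_ ?_
    · rwa [norm_smul, hμ, one_mul]
    · rwa [norm_smul, hμ, one_mul]
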